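/- Let $M$ be a Kähler manifold of complex dimension $m$ with Kähler metric $h=\sum g_{i\bar j}\,dz^i\otimes d\bar z^j$ in local holomorphic coordinates, and let $(g^{i\bar j})$ be given by $g^{i\bar l}g_{j\bar l}=\delta_{ij}$ (repeated indices are summed). Put $$\Gamma^i_{jk}=g^{i\bar l}\,\partial_k g_{j\bar l},\qquad R^l_{i\bar jk}=-\partial_{\bar j}\Gamma^l_{ik},\qquad R_{i\bar j}=R^k_{i\bar jk},\qquad R=g^{i\bar j}R_{i\bar j}.$$ Let $\phi=\phi_{12\cdots m}\,dz^1\wedge\cdots\wedge dz^m$ be a smooth $(m,0)$ form on $M$, i.e. a smooth section of the canonical bundle. Let $\nabla=\nabla^{1,0}+\nabla^{0,1}$ be the covariant derivative, with $\nabla^{1,0}\phi=\nabla_i\phi\otimes dz^i$ and $\nabla^{0,1}\phi=\nabla_{\bar i}\phi\otimes d\bar z^i$, and let $\nabla^2\phi$ be the full second covariant derivative (all components $\nabla_a\nabla_b\phi$, $a,b$ barred or unbarred). Let $\Delta$ be the complex Laplacian: $\Delta\phi=g^{i\bar j}\nabla_i\nabla_{\bar j}\phi$ on $(m,0)$ forms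 and $\Delta u=g^{i\bar j}\partial_i\partial_{\bar j}u$ on functions. Let $\langle\cdot,\cdot\rangle$ be the Hermitian inner products (linear in the first variable) induced by $\langle dz^i,dz^j\rangle=g^{i\bar j}$, $\langle d\bar z^i,d\bar z^j\rangle=\overline{g^{i\bar j}}$, $\langle dz^i,d\bar z^j\rangle=0$ and $|dz^1\wedge\cdots\wedge dz^m|^2=\det(g_{i\bar j})^{-1}$. Finally set $$Ric(\nabla^{1,0}\phi,\nabla^{1,0}\phi)=\langle R_{j\bar k}\nabla_k\phi,\nabla_j\phi\rangle,\qquad Ric(\nabla^{0,1}\phi,\nabla^{0,1}\phi)=\langle R_{k\bar j}\nabla_{\bar k}\phi,\nabla_{\bar j}\phi\rangle ,$$ where the right-hand sides are written at a point at which $g_{i\bar j}=\delta_{ij}$. Then, at every point of $M$, $$\begin{aligned}\Delta|\nabla\phi|^2={}&|\nabla^2\phi|^2+\langle\nabla\Delta\phi,\nabla\phi\rangle+\langle\nabla\phi,\nabla\Delta\phi\rangle+R|\nabla\phi|^2+\langle\phi\nabla^{1,0}R,\nabla^{1,0}\phi\rangle+\langle\nabla^{1,0}\phi,\phi\nabla^{1,0}R\rangle\\&+3\,Ric(\nabla^{1,0}\phi,\nabla^{1,0}\phi)-Ric(\nabla^{0,1}\phi,\nabla^{0,1}\phi).\end{aligned}$$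 In particular, if $M$ is Kähler–Einstein, i.e. $R_{i\bar j}=\mu g_{i\bar j}$ with a real constant $\mu$, then $R=m\mu$ and $$\Delta|\nabla\phi|^2=|\nabla^2\phi|^2+\langle\nabla\Delta\phi,\nabla\phi\rangle+\langle\nabla\phi,\nabla\Delta\phi\rangle+m\mu|\nabla\phi|^2+3\mu|\nabla^{1,0}\phi|^2-\mu|\nabla^{0,1}\phi|^2 .$$ Furthermore, if $M$ is Calabi–Yau, i.e. $\mu=0$ (equivalently $R_{i\bar j}=0$), then $$\Delta|\nabla\phi|^2=|\nabla^2\phi|^2+\langle\nabla\Delta\phi,\nabla\phi\rangle+\langle\nabla\phi,\nabla\Delta\phi\rangle .$$ -/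

import Mathlib

open scoped Manifold ContDiff ComplexConjugate

noncomputable section

namespace KahlerBochner

/-! ### Calculus in one holomorphic coordinate system

`Fin m → ℂ` is the coordinate space. Indices of the complexified tangent space are
`Fin m ⊕ Fin m`: `Sum.inl i` stands for `∂/∂zᵢ` (unbarred index) and `Sum.inr i` for
`∂/∂z̄ᵢ` (barred index). -/

/-- Wirtinger derivatives: `∂/∂zᵢ = ½ (∂/∂xᵢ - √-1 ∂/∂yᵢ)` for the index `inl i` and
`∂/∂z̄ᵢ = ½ (∂/∂xᵢ + √-1 ∂/∂yᵢ)` for the index `inr i`. -/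
def pd {m : ℕ} (a : Fin m ⊕ Fin m) (u : (Fin m → ℂ) → ℂ) (z : Fin m → ℂ) : ℂ :=
  match a with
  | .inl i => (fderiv ℝ u z (Pi.single i 1) - Complex.I * fderiv ℝ u z (Pi.single i Complex.I)) / 2
  | .inr i => (fderiv ℝ u z (Pi.single i 1) + Complex.I * fderiv ℝ u z (Pi.single i Complex.I)) / 2

/-- The matrix-valued function `z ↦ (g_{i j̄}(z))` of a Hermitian metric in coordinates. -/
abbrev LocalMetric (m : ℕ) := (Fin m → ℂ) → Matrix (Fin m) (Fin m) ℂ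

variable {m : ℕ}

/-- `g^{i j̄}`, normalized by `∑ₗ g^{i l̄} g_{j l̄} = δᵢⱼ`. -/
def gUp (G : LocalMetric m) (i j : Fin m) (z : Fin m → ℂ) : ℂ := (G z)⁻¹ j i

/-- Christoffel symbols `Γⁱⱼₖ = g^{i l̄} ∂g_{j l̄}/∂zₖ`. -/
def christoffel (G : LocalMetric m) (i j k : Fin m) (z : Fin m → ℂ) : ℂ :=
  ∑ l, gUp G i l z * pd (.inl k) (fun w => G w j l) z

/-- Christoffel symbols `Γᶜ_{a b}` of the complexified connection
(`∇_a ∂_b = ∑_c Γᶜ_{a b} ∂_c`): the only nonzero ones are `Γⁱⱼₖ` and their conjugates. -/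
def christoffelC (G : LocalMetric m) (c a b : Fin m ⊕ Fin m) (z : Fin m → ℂ) : ℂ :=
  match c, a, b with
  | .inl i, .inl j, .inl k => christoffel G i j k z
  | .inr i, .inr j, .inr k => conj (christoffel G i j k z)
  | _, _, _ => 0

/-- Curvature `Rˡ_{i j̄ k} = -∂Γˡᵢₖ/∂z̄ⱼ`. -/
def curvature (G : LocalMetric m) (l i j k : Fin m) (z : Fin m → ℂ) : ℂ :=
  - pd (.inr j) (christoffel G l i k) z

/-- Ricci curvature `R_{i j̄} = Rᵏ_{i j̄ k}`. -/
def ricci (G : LocalMetric m) (i j : Fin m) (z : Fin m → ℂ) : ℂ :=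
  ∑ k, curvature G k i j k z

/-- Scalar curvature `R = g^{i j̄} R_{i j̄}`. -/
def scalarCurv (G : LocalMetric m) (z : Fin m → ℂ) : ℂ :=
  ∑ i, ∑ j, gUp G i j z * ricci G i j z

/-- The complex Laplacian on functions, `Δu = g^{i j̄} ∂ᵢ∂_{j̄} u`. -/
def laplacian (G : LocalMetric m) (u : (Fin m → ℂ) → ℂ) (z : Fin m → ℂ) : ℂ :=
  ∑ i, ∑ j, gUp G i j z * pd (.inl i) (pd (.inr j) u) z

/-- The Hermitian inner product of the coframe of the complexified cotangent space,
`⟨dzⁱ, dzʲ⟩ = g^{i j̄}`, `⟨dz̄ⁱ, dz̄ʲ⟩ = conj (g^{i j̄})`, `⟨dzⁱ, dz̄ʲ⟩ = 0`. -/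
def gUpC (G : LocalMetric m) (a b : Fin m ⊕ Fin m) (z : Fin m → ℂ) : ℂ :=
  match a, b with
  | .inl i, .inl j => gUp G i j z
  | .inr i, .inr j => conj (gUp G i j z)
  | _, _ => 0

/-- The connection form of the canonical bundle in the frame `dz¹ ∧ ⋯ ∧ dzᵐ`:
`∇_a (dz¹ ∧ ⋯ ∧ dzᵐ) = - (∑ₖ Γᵏ_{a k}) dz¹ ∧ ⋯ ∧ dzᵐ`. -/
def connK (G : LocalMetric m) (a : Fin m ⊕ Fin m) (z : Fin m → ℂ) : ℂ :=
  ∑ k : Fin m, christoffelC G (.inl k) a (.inl k) z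

/-- Covariant derivative of the `(m,0)` form `f dz¹ ∧ ⋯ ∧ dzᵐ`: the coefficient of
`dz¹ ∧ ⋯ ∧ dzᵐ` in `∇_a (f dz¹ ∧ ⋯ ∧ dzᵐ)`. -/
def nabla (G : LocalMetric m) (f : (Fin m → ℂ) → ℂ) (a : Fin m ⊕ Fin m) (z : Fin m → ℂ) : ℂ :=
  pd a f z - connK G a z * f z

/-- Covariant derivative of a 1-form `T = ∑_b T_b dz¹ ∧ ⋯ ∧ dzᵐ ⊗ dz^b` with values in
the canonical bundle: the components `(∇T)_{a b} = ∇_a T_b`. -/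
def nabla₁ (G : LocalMetric m) (T : Fin m ⊕ Fin m → (Fin m → ℂ) → ℂ)
    (a b : Fin m ⊕ Fin m) (z : Fin m → ℂ) : ℂ :=
  pd a (T b) z - connK G a z * T b z - ∑ c, christoffelC G c a b z * T c z

/-- The second covariant derivative `∇_a ∇_b φ` of `φ = f dz¹ ∧ ⋯ ∧ dzᵐ`. -/
def nablaSq (G : LocalMetric m) (f : (Fin m → ℂ) → ℂ) (a b : Fin m ⊕ Fin m)
    (z : Fin m → ℂ) : ℂ :=
  nabla₁ G (nabla G f) a b z

/-- The complex rough Laplacian of an `(m,0)` form, `Δφ = g^{i j̄} ∇ᵢ ∇_{j̄} φ`. -/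
def laplacianK (G : LocalMetric m) (f : (Fin m → ℂ) → ℂ) (z : Fin m → ℂ) : ℂ :=
  ∑ i, ∑ j, gUp G i j z * nablaSq G f (.inl i) (.inr j) z

/-- `|dz¹ ∧ ⋯ ∧ dzᵐ|² = det (g^{i j̄}) = 1 / det (g_{i j̄})`. -/
def normSqFrame (G : LocalMetric m) (z : Fin m → ℂ) : ℂ := ((G z).det)⁻¹

/-- Hermitian inner product `⟨S, T⟩` of 1-forms with values in the canonical bundle. -/
def inner₁ (G : LocalMetric m) (S T : Fin m ⊕ Fin m → (Fin m → ℂ) → ℂ) (z : Fin m → ℂ) : ℂ :=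
  normSqFrame G z * ∑ a, ∑ b, gUpC G a b z * S a z * conj (T b z)

/-- Hermitian inner product `⟨S, T⟩` of covariant 2-tensors with values in the canonical
bundle. -/
def inner₂ (G : LocalMetric m) (S T : Fin m ⊕ Fin m → Fin m ⊕ Fin m → (Fin m → ℂ) → ℂ)
    (z : Fin m → ℂ) : ℂ :=
  normSqFrame G z *
    ∑ a, ∑ b, ∑ c, ∑ d, gUpC G a c z * gUpC G b d z * S a b z * conj (T c d z)

/-- The `(1,0)` part of a canonical-bundle-valued 1-form. -/
def part10 (T : Fin m ⊕ Fin m → (Fin m → ℂ) → ℂ) : Fin m ⊕ Fin m → (Fin m → ℂ) → ℂ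
  | .inl i => T (.inl i)
  | .inr _ => 0

/-- The `(0,1)` part of a canonical-bundle-valued 1-form. -/
def part01 (T : Fin m ⊕ Fin m → (Fin m → ℂ) → ℂ) : Fin m ⊕ Fin m → (Fin m → ℂ) → ℂ
  | .inl _ => 0
  | .inr i => T (.inr i)

/-- The Ricci endomorphism on canonical-bundle-valued 1-forms. At a point where
`g_{i j̄} = δᵢⱼ` it is `(Ric T)_j = R_{j k̄} T_k` and `(Ric T)_{j̄} = R_{k j̄} T_{k̄}`. -/
def ricciAct (G : LocalMetric m) (T : Fin m ⊕ Fin m → (Fin m → ℂ) → ℂ) :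
    Fin m ⊕ Fin m → (Fin m → ℂ) → ℂ
  | .inl j => fun z => ∑ k, ∑ l, ricci G j l z * gUp G k l z * T (.inl k) z
  | .inr j => fun z => ∑ k, ∑ l, ricci G k j z * gUp G k l z * T (.inr l) z

/-- `Ric(S, T) = ⟨Ric S, T⟩`. -/
def ricciForm (G : LocalMetric m) (S T : Fin m ⊕ Fin m → (Fin m → ℂ) → ℂ)
    (z : Fin m → ℂ) : ℂ :=
  inner₁ G (ricciAct G S) T z

/-- `φ ∇R`, with `φ = f dz¹ ∧ ⋯ ∧ dzᵐ` and `R` the scalar curvature. -/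
def mulGradScalar (G : LocalMetric m) (f : (Fin m → ℂ) → ℂ) (a : Fin m ⊕ Fin m)
    (z : Fin m → ℂ) : ℂ :=
  f z * pd a (scalarCurv G) z

/-! ### Kähler manifolds and `(m,0)` forms -/

/-- The holomorphic coordinate systems of a complex manifold. -/
abbrev holoCharts (m : ℕ) (M : Type*) [TopologicalSpace M] [ChartedSpace (Fin m → ℂ) M] :
    Set (OpenPartialHomeomorph M (Fin m → ℂ)) :=
  IsManifold.maximalAtlas 𝓘(ℂ, Fin m → ℂ) ω M

variable {M : Type*} [TopologicalSpace M] [ChartedSpace (Fin m → ℂ) M]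

/-- The coordinate vector field `∂/∂zᵢ` of the chart `e`, at the point with coordinates `z`
(the holomorphic tangent space is identified with the tangent space). -/
def coordVec (e : OpenPartialHomeomorph M (Fin m → ℂ)) (z : Fin m → ℂ) (i : Fin m) :
    TangentSpace 𝓘(ℂ, Fin m → ℂ) (e.symm z) :=
  mfderiv 𝓘(ℂ, Fin m → ℂ) 𝓘(ℂ, Fin m → ℂ) e.symm z (Pi.single i 1 : Fin m → ℂ)

/-- Components `g_{i j̄} = h(∂/∂zᵢ, ∂/∂zⱼ)` of a family of sesquilinear forms (linear in the
first, conjugate-linear in the second variable) in the chart `e`. -/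
def components
    (h : ∀ x : M, TangentSpace 𝓘(ℂ, Fin m → ℂ) x →ₗ[ℂ]
      TangentSpace 𝓘(ℂ, Fin m → ℂ) x →ₗ⋆[ℂ] ℂ)
    (e : OpenPartialHomeomorph M (Fin m → ℂ)) : LocalMetric m :=
  fun z => Matrix.of fun i j => h (e.symm z) (coordVec e z i) (coordVec e z j)

variable (m M) in
/-- A Kähler metric: a smooth Hermitian metric `h` on the tangent bundle of a complex manifold
whose Kähler form is closed. -/
structure KahlerMetric where
  /-- the Hermitian form on each tangent space -/
  herm : ∀ x : M, TangentSpace 𝓘(ℂ, Fin m → ℂ) x →ₗ[ℂ]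
    TangentSpace 𝓘(ℂ, Fin m → ℂ) x →ₗ⋆[ℂ] ℂ
  conj_symm : ∀ x v w, conj (herm x v w) = herm x w v
  pos : ∀ x v, v ≠ 0 → 0 < (herm x v v).re
  smooth : ∀ e ∈ holoCharts m M, ∀ i j,
    ContDiffOn ℝ ∞ (fun z => components herm e z i j) e.target
  /-- `dω = 0` for `ω = (√-1/2) g_{i j̄} dzⁱ ∧ dz̄ʲ`; the coefficient of `dzᵏ ∧ dzⁱ ∧ dz̄ʲ` in
  `dω` is a multiple of `∂g_{i j̄}/∂zₖ - ∂g_{k j̄}/∂zᵢ`, and the coefficients of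
  `dzⁱ ∧ dz̄ʲ ∧ dz̄ᵏ` are conjugate to these. -/
  closed : ∀ e ∈ holoCharts m M, ∀ z ∈ e.target, ∀ i j k,
    pd (.inl k) (fun w => components herm e w i j) z =
      pd (.inl i) (fun w => components herm e w k j) z

/-- The components `g_{i j̄}` of a Kähler metric in the chart `e`. -/
def KahlerMetric.inChart (g : KahlerMetric m M) (e : OpenPartialHomeomorph M (Fin m → ℂ)) :
    LocalMetric m :=
  components g.herm e

/-- `g` is Kähler–Einstein with Einstein constant `μ`: `R_{i j̄} = μ g_{i j̄}`. -/
def KahlerMetric.IsEinstein (g : KahlerMetric m M) (μ : ℝ) : Prop :=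
  ∀ e ∈ holoCharts m M, ∀ z ∈ e.target, ∀ i j,
    ricci (g.inChart e) i j z = (μ : ℂ) * g.inChart e z i j

variable (m M) in
/-- A smooth `(m,0)` form on a complex manifold of dimension `m`: a complex-multilinear
alternating form of degree `m` on each tangent space, whose coefficient `φ_{12⋯m}` is a smooth
function in every holomorphic chart. -/
structure TopForm where
  /-- the form on each tangent space -/
  form : ∀ x : M, TangentSpace 𝓘(ℂ, Fin m → ℂ) x [⋀^Fin m]→ₗ[ℂ] ℂ
  smooth : ∀ e ∈ holoCharts m M,
    ContDiffOn ℝ ∞ (fun z => form (e.symm z) (coordVec e z)) e.target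

/-- The coefficient `φ_{12⋯m} = φ(∂/∂z₁, …, ∂/∂zₘ)` in the chart `e`, so that
`φ = φ_{12⋯m} dz¹ ∧ ⋯ ∧ dzᵐ`. -/
def TopForm.coeff (φ : TopForm m M) (e : OpenPartialHomeomorph M (Fin m → ℂ))
    (z : Fin m → ℂ) : ℂ :=
  φ.form (e.symm z) (coordVec e z)

end KahlerBochner

end

open KahlerBochner

/-! The formula is an identity between polynomials in the metric, its inverse, the inverse of its
determinant, `f`, and their Wirtinger derivatives. It only needs commuting derivations exchanged by
conjugation, so it is proved in a `KahlerRing` and then evaluated at points of a chart. The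
computation is global in the chart: no normal coordinates are chosen.

Metric compatibility (`D_inner_inl`, `D_inner_inr`) gives, for any section-valued 1-form S, Δ⟨S,S⟩ =
|∇S|² + ⟨g^{ij̄}∇ᵢ∇_{j̄}S, S⟩ + ⟨S, g^{ij̄}∇_{j̄}∇ᵢS⟩ (`lap_inner`). For S = ∇φ, commuting
derivatives turns g^{ij̄}∇ᵢ∇_{j̄}∇φ into ∇Δφ + φ∇^{1,0}R + Ric(∇^{1,0}φ) (`tr_nabla_nabla_bar`). The
opposite order adds R∇φ + Ric(∇^{1,0}φ) - Ric(∇^{0,1}φ) (`tr_nabla_bar_nabla`). Thus Ric(∇^{1,0}φ)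
occurs once in the first slot and twice in the second, which explains the coefficient 3.

The curvature symmetries have two sources. Jacobi's formula makes Γᵏ_{ik} the logarithmic derivative
of det g, so symmetry of its derivatives and Hermitian symmetry of Ricci follow from commuting
derivatives of 1/det g. The Kähler condition makes Γ symmetric and identifies the other trace of the
curvature with Ricci. -/

namespace KahlerBochner

/-! ### Jacobi's formula -/

/-- **Jacobi's formula** for a derivation of a commutative ring. -/
theorem derivation_det {n A : Type*} [Fintype n] [DecidableEq n] [CommRing A]
    (D : Derivation ℤ A A) (M : Matrix n n A) :
    D M.det = ∑ i, ∑ j, M.adjugate i j * D (M j i) := by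
  have hprod : ∀ (s : Finset n) (u : n → A),
      D (∏ i ∈ s, u i) = ∑ i ∈ s, ∏ j ∈ s, Function.update u i (D (u i)) j := by
    intro s u
    induction s using Finset.induction_on with
    | empty => simp
    | insert a s ha ih =>
      rw [Finset.prod_insert ha, Derivation.leibniz, ih, Finset.sum_insert ha,
        Finset.prod_insert ha, Function.update_self, smul_eq_mul, smul_eq_mul, Finset.mul_sum,
        add_comm, mul_comm (∏ i ∈ s, u i)]
      congr 1
      · congr 1
        refine Finset.prod_congr rfl fun j hj => ?_
        rw [Function.update_of_ne (ne_of_mem_of_not_mem hj ha)]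
      · refine Finset.sum_congr rfl fun i hi => ?_
        rw [Finset.prod_insert ha, Function.update_of_ne (ne_of_mem_of_not_mem hi ha).symm]
  -- By Cramer's rule, each inner sum is the determinant with one column differentiated, so both
  -- sides become the Leibniz expansion of the determinant.
  have hrow : ∀ i, ∑ j, M.adjugate i j * D (M j i) =
      (M.updateCol i fun j => D (M j i)).det := by
    intro i
    rw [← Matrix.cramer_apply, Matrix.cramer_eq_adjugate_mulVec]
    rfl
  simp_rw [hrow, Matrix.det_apply', map_sum]
  rw [Finset.sum_comm]
  refine Finset.sum_congr rfl fun σ _ => ?_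
  rw [Derivation.leibniz, Derivation.map_intCast, smul_zero, add_zero, hprod, smul_eq_mul,
    Finset.mul_sum]
  refine Finset.sum_congr rfl fun i _ => ?_
  congr 1
  refine Finset.prod_congr rfl fun j _ => ?_
  by_cases h : j = i
  · subst h; simp
  · simp [h]

/-! ### The algebraic model of Kähler geometry -/

/-- A Kähler metric over a commutative ring `A` with involution and commuting derivations
`∂/∂zᵢ`, `∂/∂z̄ᵢ` that are exchanged by the involution: a model of the ring of smooth
functions of a coordinate domain. -/
structure KahlerRing (n A : Type*) [Fintype n] [DecidableEq n] [CommRing A] [StarRing A] where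
  /-- the Wirtinger derivatives -/
  D : n ⊕ n → Derivation ℤ A A
  D_comm : ∀ a b u, D a (D b u) = D b (D a u)
  star_D : ∀ a u, star (D a u) = D a.swap (star u)
  /-- the metric `g_{i j̄}` -/
  g : Matrix n n A
  /-- the inverse metric `g^{i j̄}` -/
  h : Matrix n n A
  h_mul : h * g.transpose = 1
  star_g : ∀ i j, star (g i j) = g j i
  closed : ∀ i j k, D (.inl k) (g i j) = D (.inl i) (g k j)
  /-- the inverse of `det g` -/
  w : A
  w_mul : w * g.det = 1

namespace KahlerRing

variable {n A : Type*} [Fintype n] [DecidableEq n] [CommRing A] [StarRing A]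
  (K : KahlerRing n A)

/-- Contraction with the inverse metric. -/
def tr (Z : n → n → A) : A := ∑ i, ∑ j, K.h i j * Z i j

def chr (i j k : n) : A := ∑ l, K.h i l * K.D (.inl k) (K.g j l)

/-- The trace `Γᵏ_{i k}` of the Christoffel symbols. -/
def chrTr (i : n) : A := ∑ k, K.chr k i k

def ricci (i j : n) : A := -K.D (.inr j) (K.chrTr i)

def scal : A := K.tr K.ricci

def nabla (f : A) : n ⊕ n → A
  | .inl i => K.D (.inl i) f - K.chrTr i * f
  | .inr i => K.D (.inr i) f

/-- Terms are missing in three of the four cases because mixed Christoffel symbols vanish and the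
canonical bundle has no connection term in barred directions. -/
def nabla₁ (T : n ⊕ n → A) : n ⊕ n → n ⊕ n → A
  | .inl i, .inl k => K.D (.inl i) (T (.inl k)) - K.chrTr i * T (.inl k)
      - ∑ c, K.chr c i k * T (.inl c)
  | .inl i, .inr k => K.D (.inl i) (T (.inr k)) - K.chrTr i * T (.inr k)
  | .inr i, .inl k => K.D (.inr i) (T (.inl k))
  | .inr i, .inr k => K.D (.inr i) (T (.inr k)) - ∑ c, star (K.chr c i k) * T (.inr c)

def lapK (f : A) : A := K.tr fun i j => K.nabla₁ (K.nabla f) (.inl i) (.inr j)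

/-- The indices are swapped in the barred part because ⟨dz̄ⁱ, dz̄ʲ⟩ is the conjugate of g^{ij̄},
that is g^{jī}. -/
def inner (S T : n ⊕ n → A) : A :=
  K.w * (K.tr (fun i j => S (.inl i) * star (T (.inl j)))
    + K.tr fun i j => S (.inr j) * star (T (.inr i)))

def ricciAct (T : n ⊕ n → A) : n ⊕ n → A
  | .inl j => K.tr fun k l => K.ricci j l * T (.inl k)
  | .inr j => K.tr fun k l => K.ricci k j * T (.inr l)

def inner₂ (S T : n ⊕ n → n ⊕ n → A) : A :=
  K.tr (fun i j => K.inner (S (.inl i)) (T (.inl j)))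
    + K.tr fun i j => K.inner (S (.inr j)) (T (.inr i))

/-! ### Contraction with the metric -/

lemma tr_add (Y Z : n → n → A) : K.tr (fun i j => Y i j + Z i j) = K.tr Y + K.tr Z := by
  simp [tr, mul_add, Finset.sum_add_distrib]

lemma tr_sub (Y Z : n → n → A) : K.tr (fun i j => Y i j - Z i j) = K.tr Y - K.tr Z := by
  simp [tr, mul_sub, Finset.sum_sub_distrib]

lemma tr_mul_left (a : A) (Z : n → n → A) : K.tr (fun i j => a * Z i j) = a * K.tr Z := by
  simp only [tr, Finset.mul_sum]
  exact Finset.sum_congr rfl fun i _ => Finset.sum_congr rfl fun j _ => by ring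

lemma tr_mul_right (a : A) (Z : n → n → A) : K.tr (fun i j => Z i j * a) = K.tr Z * a := by
  simp only [mul_comm _ a, tr_mul_left]

lemma tr_sum (Z : n → n → n → A) : K.tr (fun i j => ∑ c, Z c i j) = ∑ c, K.tr (Z c) := by
  simp only [tr, Finset.mul_sum]
  rw [Finset.sum_comm (f := fun c i => ∑ j, K.h i j * Z c i j)]
  exact Finset.sum_congr rfl fun i _ => Finset.sum_comm

lemma tr_comm (Z : n → n → n → n → A) :
    K.tr (fun i j => K.tr fun k l => Z i j k l) = K.tr fun k l => K.tr fun i j => Z i j k l := by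
  change K.tr (fun i j => ∑ k, ∑ l, K.h k l * Z i j k l) = _
  simp only [tr_sum, tr_mul_left]
  rfl

lemma tr_congr {Y Z : n → n → A} (h : ∀ i j, Y i j = Z i j) : K.tr Y = K.tr Z :=
  congrArg K.tr (funext₂ h)

lemma D_mul (a : n ⊕ n) (u v : A) : K.D a (u * v) = K.D a u * v + u * K.D a v := by
  rw [Derivation.leibniz, smul_eq_mul, smul_eq_mul]; ring

lemma mul_h : K.g.transpose * K.h = 1 := mul_eq_one_comm.mp K.h_mul

lemma star_h (i j : n) : star (K.h i j) = K.h j i := by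
  have h1 : K.h.conjTranspose * K.g.transpose = 1 := by
    have hg : K.g.transpose.conjTranspose = K.g.transpose := by
      ext i j; simp [Matrix.conjTranspose_apply, K.star_g]
    rw [← hg, ← Matrix.conjTranspose_mul, K.mul_h, Matrix.conjTranspose_one]
  have h2 : K.h.conjTranspose = K.h := by
    rw [← mul_one K.h.conjTranspose, ← K.mul_h, ← mul_assoc, h1, one_mul]
  exact congrFun (congrFun h2 j) i

lemma star_tr (Z : n → n → A) : star (K.tr Z) = K.tr fun i j => star (Z j i) := by
  simp only [tr, star_sum, star_mul', star_h]
  exact Finset.sum_comm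

lemma star_w : star K.w = K.w := by
  have h1 : star K.g.det = K.g.det := by
    have : K.g.conjTranspose = K.g := by
      ext i j; simp [Matrix.conjTranspose_apply, K.star_g]
    rw [← Matrix.det_conjTranspose, this]
  have h2 : star K.w * K.g.det = 1 := by
    rw [← h1, ← star_mul', K.w_mul, star_one]
  linear_combination star K.w * (-K.w_mul) + K.w * h2

/-- Differentiate `h_mul` and multiply on the right by `h`. -/
lemma D_h (a : n ⊕ n) (i q : n) :
    K.D a (K.h i q) = -∑ p, (∑ l, K.h i l * K.D a (K.g p l)) * K.h p q := by
  have h1 : K.h.map (K.D a) * K.g.transpose = -(K.h * K.g.transpose.map (K.D a)) := by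
    rw [eq_neg_iff_add_eq_zero]
    ext i j
    have := congrArg (K.D a) (congrFun (congrFun K.h_mul i) j)
    rw [Matrix.mul_apply, map_sum] at this
    simp only [D_mul, Finset.sum_add_distrib] at this
    rw [Matrix.add_apply, Matrix.mul_apply, Matrix.mul_apply]
    refine this.trans ?_
    rw [Matrix.one_apply]
    split_ifs <;> simp
  have h2 : K.h.map (K.D a) = -(K.h * K.g.transpose.map (K.D a)) * K.h := by
    rw [← h1, mul_assoc, K.mul_h, mul_one]
  have := congrFun (congrFun h2 i) q
  rw [neg_mul, Matrix.neg_apply, Matrix.mul_apply] at this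
  simpa only [Matrix.mul_apply, Matrix.map_apply, Matrix.transpose_apply] using this

/-- The Kähler condition is exactly the absence of torsion. -/
lemma chr_symm (i j k : n) : K.chr i j k = K.chr i k j := by
  simp only [chr, K.closed j _ k]

lemma star_chr (i j k : n) : star (K.chr i j k) = ∑ l, K.h l i * K.D (.inr k) (K.g l j) := by
  simp [chr, star_sum, star_h, star_D, star_g]

/-- The inverse metric is parallel: its derivative becomes the Christoffel correction of the
unbarred index, and the barred index needs none. -/
lemma D_tr_inl (k : n) (Z : n → n → A) : K.D (.inl k) (K.tr Z) =
    K.tr fun i j => K.D (.inl k) (Z i j) - ∑ c, K.chr c i k * Z c j := by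
  rw [tr_sub, tr_sum]
  simp only [tr, map_sum, D_mul, D_h, Finset.sum_add_distrib]
  rw [add_comm, sub_eq_add_neg]
  congr 1
  simp only [neg_mul, Finset.sum_neg_distrib, neg_inj, Finset.sum_mul]
  refine Finset.sum_congr rfl fun i _ => ?_
  rw [Finset.sum_comm]
  refine Finset.sum_congr rfl fun p _ => Finset.sum_congr rfl fun j _ => ?_
  rw [← Finset.sum_mul, ← Finset.sum_mul, ← chr]
  ring

lemma D_tr_inr (k : n) (Z : n → n → A) : K.D (.inr k) (K.tr Z) =
    K.tr fun i j => K.D (.inr k) (Z i j) - ∑ c, star (K.chr c j k) * Z i c := by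
  have h := congrArg star (K.D_tr_inl k fun i j => star (Z j i))
  rw [star_D, star_tr, star_tr] at h
  simpa [star_D, star_sum, mul_comm] using h

/-- Jacobi's formula says Γᵏ_{ik} = ∂ᵢ log det g. Hence `w`, the squared norm of dz¹∧⋯∧dzᵐ,
differentiates by the connection form of the canonical bundle. -/
lemma D_w_inl (k : n) : K.D (.inl k) K.w = -(K.w * K.chrTr k) := by
  have hadj : ∀ i j, K.w * K.g.adjugate i j = K.h j i := by
    have h1 : (K.w • K.g.adjugate) * K.g = 1 := by
      rw [Matrix.smul_mul, Matrix.adjugate_mul, smul_smul, K.w_mul, one_smul]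
    have h2 : K.g * K.h.transpose = 1 := by
      rw [← Matrix.transpose_transpose K.g, ← Matrix.transpose_mul, K.h_mul,
        Matrix.transpose_one]
    have h3 : K.w • K.g.adjugate = K.h.transpose := by
      rw [← mul_one (K.w • _), ← h2, ← mul_assoc, h1, one_mul]
    intro i j
    exact congrFun (congrFun h3 i) j
  have h1 : K.w * K.D (.inl k) K.g.det = K.chrTr k := by
    simp only [derivation_det, Finset.mul_sum, ← mul_assoc, hadj, chrTr, K.chr_symm _ k]
    exact Finset.sum_comm
  have h2 := congrArg (K.D (.inl k)) K.w_mul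
  rw [D_mul, Derivation.map_one_eq_zero] at h2
  -- The derivative of `w * det g = 1`, multiplied by `w` to remove the determinant.
  linear_combination K.w * h2 - K.D (.inl k) K.w * K.w_mul - K.w * h1

lemma D_w_inr (k : n) : K.D (.inr k) K.w = -(K.w * star (K.chrTr k)) := by
  have h := congrArg star (K.D_w_inl k)
  rw [star_D, star_neg, star_mul', star_w] at h
  exact h

lemma w_cancel {u v : A} (h : K.w * u = K.w * v) : u = v := by
  linear_combination K.g.det * h + (v - u) * K.w_mul

/-- Γᵏ_{ik} is minus the logarithmic derivative of `w`. Commuting two derivatives of `w` and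
cancelling the unit `w` replaces the use of a logarithm; the same device proves `star_ricci`. -/
lemma D_chrTr_comm (i k : n) : K.D (.inl i) (K.chrTr k) = K.D (.inl k) (K.chrTr i) := by
  apply K.w_cancel
  have h := K.D_comm (.inl i) (.inl k) K.w
  simp only [D_w_inl, map_neg, D_mul] at h
  linear_combination -h

lemma star_ricci (i j : n) : star (K.ricci i j) = K.ricci j i := by
  apply K.w_cancel
  have h := K.D_comm (.inl j) (.inr i) K.w
  simp only [D_w_inl, D_w_inr, map_neg, D_mul] at h
  simp only [ricci, star_neg, star_D, Sum.swap_inr]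
  linear_combination h

lemma D_ricci_comm (i j k : n) : K.D (.inl i) (K.ricci k j) = K.D (.inl k) (K.ricci i j) := by
  simp only [ricci, map_neg, K.D_comm (.inl _), K.D_chrTr_comm i k]

lemma star_scal : star K.scal = K.scal := by
  simp only [scal, star_tr, star_ricci]

/-! ### Curvature symmetries -/

/-- The lowered curvature, up to sign. -/
def curvLow (i k q j : n) : A :=
  K.D (.inr j) (K.D (.inl k) (K.g i q)) - ∑ l, star (K.chr l q j) * K.D (.inl k) (K.g i l)

lemma closed_inr (i j k : n) : K.D (.inr k) (K.g i j) = K.D (.inr j) (K.g i k) := by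
  have := congrArg star (K.closed j i k)
  simpa [star_D, star_g] using this

/-- Both terms are symmetric by the Kähler condition: the first by closedness in the barred indices,
the second because Γ is symmetric. -/
lemma curvLow_symm_right (i k q j : n) : K.curvLow i k q j = K.curvLow i k j q := by
  simp only [curvLow, K.chr_symm _ q j, K.D_comm (.inr _), K.closed_inr i q j]

lemma D_h_inr (i j k : n) :
    K.D (.inr k) (K.h i j) = -∑ q, K.h i q * star (K.chr j q k) := by
  simp only [D_h, star_chr, Finset.sum_mul, Finset.mul_sum]
  rw [Finset.sum_comm]
  congr 1
  exact Finset.sum_congr rfl fun q _ => Finset.sum_congr rfl fun p _ => by ring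

lemma D_chr_inr (c i k j : n) :
    K.D (.inr j) (K.chr c i k) = ∑ q, K.h c q * K.curvLow i k q j := by
  rw [chr]
  simp only [map_sum, D_mul, D_h_inr, Finset.sum_add_distrib]
  simp only [curvLow, mul_sub, Finset.sum_sub_distrib]
  rw [add_comm, sub_eq_add_neg]
  congr 1
  simp only [neg_mul, Finset.sum_neg_distrib, neg_inj, Finset.sum_mul, Finset.mul_sum]
  rw [Finset.sum_comm]
  exact Finset.sum_congr rfl fun q _ => Finset.sum_congr rfl fun p _ => by ring

/-- Ricci is defined by tracing the upper index of the curvature, whereas commuting derivatives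
contracts the metric with a derivative index. Symmetry in the barred indices of `curvLow` makes the
two traces agree. -/
lemma tr_D_chr (c k : n) :
    K.tr (fun i j => K.D (.inr j) (K.chr c i k)) = -∑ l, K.h c l * K.ricci k l := by
  simp only [tr, ricci, chrTr, K.chr_symm _ k, map_sum, D_chr_inr, mul_neg,
    Finset.sum_neg_distrib, neg_neg, Finset.mul_sum]
  simp only [Finset.sum_comm (f := fun q i => ∑ j, K.h c q * (K.h i j * K.curvLow i k j q))]
  refine Finset.sum_congr rfl fun i _ => ?_
  rw [Finset.sum_comm]
  refine Finset.sum_congr rfl fun q _ => Finset.sum_congr rfl fun j _ => ?_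
  rw [K.curvLow_symm_right i k q j]
  ring

lemma tr_D_chr' (c k : n) :
    K.tr (fun i j => K.D (.inl i) (star (K.chr c j k))) = -∑ l, K.h l c * K.ricci l k := by
  have h := congrArg star (K.tr_D_chr c k)
  rw [star_tr] at h
  simpa [star_D, star_h, star_ricci, star_sum] using h

/-! ### The Hermitian product and metric compatibility -/

lemma star_inner (S T : n ⊕ n → A) : star (K.inner S T) = K.inner T S := by
  simp only [inner, star_mul', star_add, star_tr, star_w, star_star, mul_comm (star _)]

lemma inner_add_left (S S' T : n ⊕ n → A) :
    K.inner (fun a => S a + S' a) T = K.inner S T + K.inner S' T := by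
  simp only [inner, add_mul, tr_add]; ring

lemma inner_sub_left (S S' T : n ⊕ n → A) :
    K.inner (fun a => S a - S' a) T = K.inner S T - K.inner S' T := by
  simp only [inner, sub_mul, tr_sub]; ring

lemma inner_mul_left (u : A) (S T : n ⊕ n → A) :
    K.inner (fun a => u * S a) T = u * K.inner S T := by
  simp only [inner, mul_assoc, tr_mul_left]; ring

lemma inner_sum_left (S : n → n ⊕ n → A) (T : n ⊕ n → A) :
    K.inner (fun a => ∑ i, S i a) T = ∑ i, K.inner (S i) T := by
  simp only [inner, Finset.sum_mul, tr_sum, ← Finset.mul_sum, ← Finset.sum_add_distrib]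

lemma inner_tr_left (S : n → n → n ⊕ n → A) (T : n ⊕ n → A) :
    K.inner (fun a => K.tr fun i j => S i j a) T = K.tr fun i j => K.inner (S i j) T := by
  simp only [tr, inner_sum_left, inner_mul_left]

lemma inner_tr_right (S : n ⊕ n → A) (T : n → n → n ⊕ n → A) :
    K.inner S (fun a => K.tr fun i j => T j i a) = K.tr fun i j => K.inner S (T i j) := by
  rw [← star_inner, inner_tr_left, star_tr]
  simp only [star_inner]

/-- The derivative of `w` supplies the canonical-bundle connection term of S. The correction in
`D_tr_inl` falls on S for unbarred components and on the conjugate of T for barred ones. -/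
lemma D_inner_inl (k : n) (S T : n ⊕ n → A) : K.D (.inl k) (K.inner S T) =
    K.inner (K.nabla₁ S (.inl k)) T + K.inner S (K.nabla₁ T (.inr k)) := by
  have h1 : (K.tr fun i j => K.D (.inl k) (S (.inl i) * star (T (.inl j)))
        - ∑ c, K.chr c i k * (S (.inl c) * star (T (.inl j)))) =
      K.tr fun i j => (K.nabla₁ S (.inl k) (.inl i) * star (T (.inl j))
        + S (.inl i) * star (K.nabla₁ T (.inr k) (.inl j)))
        + K.chrTr k * (S (.inl i) * star (T (.inl j))) := by
    refine K.tr_congr fun i j => ?_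
    simp only [nabla₁, D_mul, star_D, Sum.swap_inr, K.chr_symm _ k, sub_mul, Finset.sum_mul,
      mul_assoc]
    ring
  have h2 : (K.tr fun i j => K.D (.inl k) (S (.inr j) * star (T (.inr i)))
        - ∑ c, K.chr c i k * (S (.inr j) * star (T (.inr c)))) =
      K.tr fun i j => (K.nabla₁ S (.inl k) (.inr j) * star (T (.inr i))
        + S (.inr j) * star (K.nabla₁ T (.inr k) (.inr i)))
        + K.chrTr k * (S (.inr j) * star (T (.inr i))) := by
    refine K.tr_congr fun i j => ?_
    simp only [nabla₁, D_mul, star_D, Sum.swap_inr, K.chr_symm _ k, star_sub, star_sum,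
      star_mul', star_star, mul_sub, Finset.mul_sum, mul_left_comm (S _)]
    ring
  rw [inner, D_mul, map_add, D_tr_inl, D_tr_inl, D_w_inl, h1, h2]
  simp only [inner, tr_add, tr_mul_left]
  ring

lemma D_inner_inr (k : n) (S T : n ⊕ n → A) : K.D (.inr k) (K.inner S T) =
    K.inner (K.nabla₁ S (.inr k)) T + K.inner S (K.nabla₁ T (.inl k)) := by
  have h := congrArg star (K.D_inner_inl k T S)
  rw [star_D, star_add, star_inner, star_inner, star_inner, add_comm] at h
  exact h

/-- The `(1,0)` part of a 1-form. -/
def part10 (T : n ⊕ n → A) : n ⊕ n → A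
  | .inl i => T (.inl i)
  | .inr _ => 0

/-- The `(0,1)` part of a 1-form. -/
def part01 (T : n ⊕ n → A) : n ⊕ n → A
  | .inl _ => 0
  | .inr i => T (.inr i)

/-! ### Commuting covariant derivatives -/

/-- The commutation formula for `g^{i j̄} ∇ᵢ ∇_{j̄} ∇φ`. -/
lemma tr_nabla_nabla_bar (f : A) (a : n ⊕ n) :
    K.tr (fun i j => K.nabla₁ (K.nabla₁ (K.nabla f) (.inr j)) (.inl i) a) =
      K.nabla (K.lapK f) a + part10 (fun b => f * K.D b K.scal) a
        + K.ricciAct (part10 (K.nabla f)) a := by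
  rcases a with k | k
  -- The Christoffel terms are grouped so that `D_tr_inl` recognises the derivatives of Δf and of
  -- the scalar curvature after tracing.
  · have h1 : ∀ i j, K.nabla₁ (K.nabla₁ (K.nabla f) (.inr j)) (.inl i) (.inl k) =
        (K.D (.inl k) (K.nabla₁ (K.nabla f) (.inl i) (.inr j))
          - ∑ c, K.chr c i k * K.nabla₁ (K.nabla f) (.inl c) (.inr j))
        - K.chrTr k * K.nabla₁ (K.nabla f) (.inl i) (.inr j)
        + f * (K.D (.inl k) (K.ricci i j) - ∑ c, K.chr c i k * K.ricci c j)
        + K.ricci k j * K.nabla f (.inl i) := by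
      intro i j
      -- This commutator is the curvature of the canonical bundle. Differentiating its Ricci term
      -- later yields both φ∇R and the Ricci action on ∇φ.
      have hX : ∀ c, K.D (.inr j) (K.D (.inl c) f - K.chrTr c * f) =
          K.D (.inl c) (K.D (.inr j) f) - K.chrTr c * K.D (.inr j) f + K.ricci c j * f := by
        intro c
        rw [map_sub, D_mul, K.D_comm (.inr j), ricci]; ring
      simp only [nabla₁, nabla, hX]
      simp only [map_add, map_sub, D_mul, K.D_chrTr_comm i k, K.D_ricci_comm i j k, mul_add,
        mul_sub, Finset.sum_add_distrib, Finset.sum_sub_distrib, ← mul_assoc,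
        ← Finset.sum_mul, K.D_comm (.inl i) (.inl k)]
      ring
    simp only [h1]
    rw [tr_add, tr_add, tr_sub, tr_mul_left, tr_mul_left, ← D_tr_inl, ← D_tr_inl]
    rfl
  -- In the last bracket the curvature of the canonical bundle and that of the barred cotangent
  -- index cancel after tracing, so no Ricci term survives.
  · have h1 : ∀ i j, K.nabla₁ (K.nabla₁ (K.nabla f) (.inr j)) (.inl i) (.inr k) =
        (K.D (.inr k) (K.nabla₁ (K.nabla f) (.inl i) (.inr j))
          - ∑ c, star (K.chr c j k) * K.nabla₁ (K.nabla f) (.inl i) (.inr c))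
        - (K.ricci i k * K.D (.inr j) f
          + ∑ c, K.D (.inl i) (star (K.chr c j k)) * K.D (.inr c) f) := by
      intro i j
      simp only [nabla₁, nabla, ricci]
      simp only [map_sub, map_sum, D_mul, mul_sub, Finset.sum_add_distrib,
        Finset.sum_sub_distrib, Finset.mul_sum, mul_left_comm (K.chrTr i),
        K.D_comm (.inr j) (.inr k), K.D_comm (.inl i) (.inr k)]
      ring
    simp only [h1]
    rw [tr_sub, ← D_tr_inr, tr_add, tr_sum]
    simp only [tr_mul_right, tr_D_chr', neg_mul, Finset.sum_neg_distrib, Finset.sum_mul,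
      part10, ricciAct, mul_zero]
    have h2 : K.tr (fun i j => K.ricci i k * K.D (.inr j) f) =
        ∑ j, ∑ i, K.h i j * K.ricci i k * K.D (.inr j) f := by
      rw [tr, Finset.sum_comm]
      simp only [mul_assoc]
    rw [show K.tr (fun _ _ => (0 : A)) = 0 by simp [tr], h2, add_neg_cancel, sub_zero, add_zero,
      add_zero]
    rfl

/-- The traced commutator [∇_{j̄}, ∇ᵢ] acts by R through the canonical bundle, and by Ricci of
opposite signs through the unbarred and barred cotangent indices. -/
lemma tr_nabla_bar_nabla (T : n ⊕ n → A) (a : n ⊕ n) :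
    K.tr (fun i j => K.nabla₁ (K.nabla₁ T (.inl i)) (.inr j) a) =
      K.tr (fun i j => K.nabla₁ (K.nabla₁ T (.inr j)) (.inl i) a) + K.scal * T a
        + K.ricciAct (part10 T) a - K.ricciAct (part01 T) a := by
  have h0 : K.tr (fun _ _ => (0 : A)) = 0 := by simp [tr]
  rcases a with k | k
  · have h1 : ∀ i j, K.nabla₁ (K.nabla₁ T (.inl i)) (.inr j) (.inl k) =
        K.nabla₁ (K.nabla₁ T (.inr j)) (.inl i) (.inl k) + K.ricci i j * T (.inl k)
          - ∑ c, K.D (.inr j) (K.chr c i k) * T (.inl c) := by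
      intro i j
      simp only [nabla₁, ricci]
      simp only [map_sub, map_sum, D_mul, Finset.sum_add_distrib,
        K.D_comm (.inr j) (.inl i)]
      ring
    simp only [h1]
    rw [tr_sub, tr_add, tr_sum]
    simp only [tr_mul_right, tr_D_chr, neg_mul, Finset.sum_neg_distrib, Finset.sum_mul,
      part10, part01, ricciAct, mul_zero, h0, sub_neg_eq_add, sub_zero]
    simp only [tr, mul_assoc, scal]
  · have h1 : ∀ i j, K.nabla₁ (K.nabla₁ T (.inl i)) (.inr j) (.inr k) =
        K.nabla₁ (K.nabla₁ T (.inr j)) (.inl i) (.inr k) + K.ricci i j * T (.inr k)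
          + ∑ c, K.D (.inl i) (star (K.chr c j k)) * T (.inr c) := by
      intro i j
      simp only [nabla₁, ricci]
      simp only [map_sub, map_sum, D_mul, mul_sub, Finset.sum_add_distrib,
        Finset.sum_sub_distrib, Finset.mul_sum, mul_left_comm (K.chrTr i),
        K.D_comm (.inr j) (.inl i)]
      ring
    simp only [h1]
    rw [tr_add, tr_add, tr_sum]
    simp only [tr_mul_right, tr_D_chr', neg_mul, Finset.sum_neg_distrib, Finset.sum_mul,
      part10, part01, ricciAct, mul_zero, h0, add_zero, ← sub_eq_add_neg]
    congr 1
    rw [tr, Finset.sum_comm]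
    simp only [mul_assoc]

lemma star_inner_ricciAct (S T : n ⊕ n → A) :
    star (K.inner (K.ricciAct S) T) = K.inner (K.ricciAct T) S := by
  rw [star_inner]
  simp only [inner, ricciAct, star_tr, star_mul', star_ricci, ← tr_mul_left, ← tr_mul_right]
  rw [K.tr_comm, K.tr_comm fun i j k l => _ * star (S (.inr i))]
  congr 2
  · exact K.tr_congr fun i j => K.tr_congr fun k l => by ring
  · exact K.tr_congr fun i j => K.tr_congr fun k l => by ring

/-! ### The Bochner formula in the ring -/

/-- The complex Laplacian on functions. -/
def lap (u : A) : A := K.tr fun i j => K.D (.inl i) (K.D (.inr j) u)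

/-- Two applications of metric compatibility. The index of the inner derivative may be treated as a
label, since mixed Christoffel symbols vanish. -/
lemma lap_inner (S : n ⊕ n → A) : K.lap (K.inner S S) =
    K.inner₂ (K.nabla₁ S) (K.nabla₁ S)
      + K.inner (fun a => K.tr fun i j => K.nabla₁ (K.nabla₁ S (.inr j)) (.inl i) a) S
      + K.inner S (fun a => K.tr fun i j => K.nabla₁ (K.nabla₁ S (.inl i)) (.inr j) a) := by
  rw [inner_tr_left, K.inner_tr_right S fun i j a => K.nabla₁ (K.nabla₁ S (.inl j)) (.inr i) a]
  simp only [lap, D_inner_inr, map_add, D_inner_inl, tr_add, inner₂]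
  ring

lemma inner_add_right (S T T' : n ⊕ n → A) :
    K.inner S (fun a => T a + T' a) = K.inner S T + K.inner S T' := by
  rw [← star_inner, inner_add_left, star_add, star_inner, star_inner]

lemma inner_sub_right (S T T' : n ⊕ n → A) :
    K.inner S (fun a => T a - T' a) = K.inner S T - K.inner S T' := by
  rw [← star_inner, inner_sub_left, star_sub, star_inner, star_inner]

lemma inner_mul_right (u : A) (S T : n ⊕ n → A) :
    K.inner S (fun a => u * T a) = star u * K.inner S T := by
  rw [← star_inner, inner_mul_left, star_mul', star_inner]

lemma inner_part10 (S T : n ⊕ n → A) : K.inner (part10 S) (part10 T) = K.inner (part10 S) T := by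
  simp [inner, part10]

lemma inner_ricciAct_part10 (S T : n ⊕ n → A) :
    K.inner (K.ricciAct (part10 S)) (part10 T) = K.inner (K.ricciAct (part10 S)) T := by
  simp [inner, part10, ricciAct, tr]

lemma inner_ricciAct_part01 (S T : n ⊕ n → A) :
    K.inner (K.ricciAct (part01 S)) (part01 T) = K.inner (K.ricciAct (part01 S)) T := by
  simp [inner, part01, ricciAct, tr]

/-- The Bochner formula for `(m,0)` forms. -/
theorem lap_inner_nabla (f : A) : K.lap (K.inner (K.nabla f) (K.nabla f)) =
    K.inner₂ (K.nabla₁ (K.nabla f)) (K.nabla₁ (K.nabla f))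
      + K.inner (K.nabla (K.lapK f)) (K.nabla f)
      + K.inner (K.nabla f) (K.nabla (K.lapK f))
      + K.scal * K.inner (K.nabla f) (K.nabla f)
      + K.inner (part10 fun b => f * K.D b K.scal) (part10 (K.nabla f))
      + K.inner (part10 (K.nabla f)) (part10 fun b => f * K.D b K.scal)
      + 3 * K.inner (K.ricciAct (part10 (K.nabla f))) (part10 (K.nabla f))
      - K.inner (K.ricciAct (part01 (K.nabla f))) (part01 (K.nabla f)) := by
  have h10 : K.inner (K.nabla f) (K.ricciAct (part10 (K.nabla f))) =
      K.inner (K.ricciAct (part10 (K.nabla f))) (part10 (K.nabla f)) := by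
    rw [← star_inner, ← inner_ricciAct_part10, star_inner_ricciAct]
  have h01 : K.inner (K.nabla f) (K.ricciAct (part01 (K.nabla f))) =
      K.inner (K.ricciAct (part01 (K.nabla f))) (part01 (K.nabla f)) := by
    rw [← star_inner, ← inner_ricciAct_part01, star_inner_ricciAct]
  have hR : K.inner (K.nabla f) (part10 fun b => f * K.D b K.scal) =
      K.inner (part10 (K.nabla f)) (part10 fun b => f * K.D b K.scal) := by
    rw [← star_inner, ← inner_part10, star_inner]
  rw [lap_inner]
  -- The right slot contributes two copies of the (1,0) Ricci term and the left slot one;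
  -- self-adjointness of Ricci makes the copies equal.
  simp only [tr_nabla_bar_nabla, tr_nabla_nabla_bar, inner_add_left, inner_add_right,
    inner_sub_right, inner_mul_right, star_scal, h10, h01, hR]
  rw [← inner_part10, ← inner_ricciAct_part10]
  ring

end KahlerRing
variable {m : ℕ}

/-! ### Wirtinger calculus -/

/-- A common shape for barred and unbarred derivatives, so that calculus rules need no case split.
-/
lemma pd_eq (a : Fin m ⊕ Fin m) : ∃ (c : ℂ) (v v' : Fin m → ℂ),
    ∀ u z, pd a u z = (fderiv ℝ u z v + c * fderiv ℝ u z v') / 2 := by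
  rcases a with i | i
  · exact ⟨-Complex.I, Pi.single i 1, Pi.single i Complex.I, fun u z => by rw [pd]; ring⟩
  · exact ⟨Complex.I, Pi.single i 1, Pi.single i Complex.I, fun u z => rfl⟩

lemma pd_congr {a : Fin m ⊕ Fin m} {u v : (Fin m → ℂ) → ℂ} {z : Fin m → ℂ}
    (h : u =ᶠ[nhds z] v) : pd a u z = pd a v z := by
  obtain ⟨c, x, y, hp⟩ := pd_eq a
  rw [hp, hp, h.fderiv_eq]

lemma pd_const (a : Fin m ⊕ Fin m) (c : ℂ) (z : Fin m → ℂ) : pd a (fun _ => c) z = 0 := by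
  obtain ⟨c, x, y, hp⟩ := pd_eq a
  rw [hp]; simp

lemma pd_add (a : Fin m ⊕ Fin m) {u v : (Fin m → ℂ) → ℂ} {z : Fin m → ℂ}
    (hu : DifferentiableAt ℝ u z) (hv : DifferentiableAt ℝ v z) :
    pd a (u + v) z = pd a u z + pd a v z := by
  obtain ⟨c, x, y, hp⟩ := pd_eq a
  rw [hp, hp, hp, fderiv_add hu hv]
  simp only [add_apply]
  ring

lemma pd_mul (a : Fin m ⊕ Fin m) {u v : (Fin m → ℂ) → ℂ} {z : Fin m → ℂ}
    (hu : DifferentiableAt ℝ u z) (hv : DifferentiableAt ℝ v z) :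
    pd a (u * v) z = u z * pd a v z + v z * pd a u z := by
  obtain ⟨c, x, y, hp⟩ := pd_eq a
  rw [hp, hp, hp, fderiv_mul hu hv]
  simp only [add_apply, smul_apply, smul_eq_mul]
  ring

lemma pd_star (a : Fin m ⊕ Fin m) {u : (Fin m → ℂ) → ℂ} {z : Fin m → ℂ}
    (hu : DifferentiableAt ℝ u z) : conj (pd a u z) = pd a.swap (star u) z := by
  have h : ∀ x, fderiv ℝ (star u) z x = conj (fderiv ℝ u z x) := by
    intro x
    have h1 : HasFDerivAt (star u) ((Complex.conjCLE : ℂ →L[ℝ] ℂ).comp (fderiv ℝ u z)) z :=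
      (Complex.conjCLE : ℂ →L[ℝ] ℂ).hasFDerivAt.comp z hu.hasFDerivAt
    rw [h1.fderiv]
    rfl
  have h2 : (starRingEnd ℂ) 2 = 2 := Complex.conj_ofNat 2
  rcases a with i | i <;> simp [pd, h, h2, sub_eq_add_neg]

lemma contDiffOn_pd (a : Fin m ⊕ Fin m) {u : (Fin m → ℂ) → ℂ} {U : Set (Fin m → ℂ)}
    (hU : IsOpen U) (hu : ContDiffOn ℝ ∞ u U) : ContDiffOn ℝ ∞ (pd a u) U := by
  obtain ⟨c, x, y, hp⟩ := pd_eq a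
  have h : ContDiffOn ℝ ∞ (fderiv ℝ u) U := hu.fderiv_of_isOpen hU le_rfl
  rw [show pd a u = fun z => (fderiv ℝ u z x + c * fderiv ℝ u z y) / 2 from funext (hp u)]
  exact ((h.clm_apply contDiffOn_const).add
    (contDiffOn_const.mul (h.clm_apply contDiffOn_const))).div_const 2

lemma pd_comm (a b : Fin m ⊕ Fin m) {u : (Fin m → ℂ) → ℂ} {z : Fin m → ℂ}
    (hu : ContDiffAt ℝ ∞ u z) : pd a (pd b u) z = pd b (pd a u) z := by
  obtain ⟨c, x, y, hp⟩ := pd_eq a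
  obtain ⟨d, x', y', hq⟩ := pd_eq b
  have hF : DifferentiableAt ℝ (fderiv ℝ u) z :=
    (hu.fderiv_right (m := ∞) le_rfl).differentiableAt (by simp)
  have hsymm : IsSymmSndFDerivAt ℝ u z := hu.isSymmSndFDerivAt (by simpa using ENat.LEInfty.out)
  have key : ∀ (e : ℂ) (v v' w : Fin m → ℂ),
      fderiv ℝ (fun z => (fderiv ℝ u z v + e * fderiv ℝ u z v') / 2) z w =
        (fderiv ℝ (fderiv ℝ u) z w v + e * fderiv ℝ (fderiv ℝ u) z w v') / 2 := by
    intro e v v' w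
    have h1 : ∀ v, HasFDerivAt (fun z => fderiv ℝ u z v)
        ((ContinuousLinearMap.apply ℝ ℂ v).comp (fderiv ℝ (fderiv ℝ u) z)) z := fun v =>
      (ContinuousLinearMap.apply ℝ ℂ v).hasFDerivAt.comp z hF.hasFDerivAt
    have h2 := ((h1 v).add ((h1 v').const_mul e)).mul_const (2⁻¹ : ℂ)
    simp only [div_eq_mul_inv]
    erw [HasFDerivAt.fderiv h2]
    simp [mul_comm, mul_add]
  rw [hp, hq, funext (hp u), funext (hq u), key, key, key, key, hsymm x x', hsymm x y',
    hsymm y x', hsymm y y']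
  ring

/-! ### The ring of functions smooth on a coordinate domain -/

/-- The functions that are smooth on `U`. -/
noncomputable def smoothOn (U : Set (Fin m → ℂ)) : StarSubalgebra ℝ ((Fin m → ℂ) → ℂ) where
  carrier := {u | ContDiffOn ℝ ∞ u U}
  mul_mem' hu hv := ContDiffOn.mul hu hv
  add_mem' hu hv := ContDiffOn.add hu hv
  algebraMap_mem' _ := contDiffOn_const
  star_mem' hu := (Complex.conjCLE : ℂ →L[ℝ] ℂ).contDiff.comp_contDiffOn hu

/-- Evaluation at a point. -/
noncomputable def evalAt (U : Set (Fin m → ℂ)) (z : Fin m → ℂ) : smoothOn U →+* ℂ :=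
  (Pi.evalRingHom (fun _ => ℂ) z).comp (smoothOn U).subtype.toRingHom

lemma evalAt_star {U : Set (Fin m → ℂ)} (z : Fin m → ℂ) (u : smoothOn U) :
    evalAt U z (star u) = conj (evalAt U z u) := rfl

lemma smoothOn_ext {U : Set (Fin m → ℂ)} {u v : smoothOn U}
    (h : ∀ z, evalAt U z u = evalAt U z v) : u = v :=
  Subtype.ext (funext h)

lemma differentiableAt_smoothOn {U : Set (Fin m → ℂ)} (hU : IsOpen U) (u : smoothOn U)
    {z : Fin m → ℂ} (hz : z ∈ U) : DifferentiableAt ℝ u.1 z :=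
  ((u.2 : ContDiffOn ℝ ∞ u.1 U).contDiffAt (hU.mem_nhds hz)).differentiableAt (by simp)

open Classical in
/-- The Wirtinger derivatives on functions that are smooth on `U`, extended by zero. -/
noncomputable def pdOn {U : Set (Fin m → ℂ)} (hU : IsOpen U) (a : Fin m ⊕ Fin m) :
    Derivation ℤ (smoothOn U) (smoothOn U) :=
  Derivation.mk'
    (AddMonoidHom.toIntLinearMap
      (AddMonoidHom.mk' (fun u : smoothOn U => (⟨U.indicator (pd a u.1),
        (contDiffOn_pd a hU u.2).congr fun z hz => Set.indicator_of_mem hz _⟩ : smoothOn U))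
        (by
          intro u v
          ext z
          by_cases hz : z ∈ U
          · simpa [hz] using pd_add a (differentiableAt_smoothOn hU u hz)
              (differentiableAt_smoothOn hU v hz)
          · simp [hz])))
    (by
      intro u v
      ext z
      by_cases hz : z ∈ U
      · simpa [hz] using pd_mul a (differentiableAt_smoothOn hU u hz)
          (differentiableAt_smoothOn hU v hz)
      · simp [hz])

lemma pdOn_apply {U : Set (Fin m → ℂ)} (hU : IsOpen U) (a : Fin m ⊕ Fin m) (u : smoothOn U) :
    (pdOn hU a u).1 = U.indicator (pd a u.1) := rfl

lemma pdOn_comm {U : Set (Fin m → ℂ)} (hU : IsOpen U) (a b : Fin m ⊕ Fin m) (u : smoothOn U) :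
    pdOn hU a (pdOn hU b u) = pdOn hU b (pdOn hU a u) := by
  refine Subtype.ext (funext fun z => ?_)
  simp only [pdOn_apply]
  by_cases hz : z ∈ U
  · have h : ∀ c : Fin m ⊕ Fin m, U.indicator (pd c u.1) =ᶠ[nhds z] pd c u.1 := fun c =>
      Filter.eventuallyEq_of_mem (hU.mem_nhds hz) fun y hy => Set.indicator_of_mem hy _
    rw [Set.indicator_of_mem hz, Set.indicator_of_mem hz, pd_congr (h b), pd_congr (h a)]
    exact pd_comm a b ((u.2 : ContDiffOn ℝ ∞ u.1 U).contDiffAt (hU.mem_nhds hz))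
  · rw [Set.indicator_of_notMem hz, Set.indicator_of_notMem hz]

lemma star_pdOn {U : Set (Fin m → ℂ)} (hU : IsOpen U) (a : Fin m ⊕ Fin m) (u : smoothOn U) :
    star (pdOn hU a u) = pdOn hU a.swap (star u) := by
  refine Subtype.ext (funext fun z => ?_)
  by_cases hz : z ∈ U
  · have := pd_star a (differentiableAt_smoothOn hU u hz)
    simpa [pdOn_apply, hz] using this
  · simp [pdOn_apply, hz]

lemma contDiffOn_det {n : Type*} [Fintype n] [DecidableEq n] {U : Set (Fin m → ℂ)}
    {M : (Fin m → ℂ) → Matrix n n ℂ} (hM : ∀ i j, ContDiffOn ℝ ∞ (fun z => M z i j) U) :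
    ContDiffOn ℝ ∞ (fun z => (M z).det) U := by
  simp only [Matrix.det_apply']
  exact ContDiffOn.sum fun σ _ => contDiffOn_const.mul (contDiffOn_prod fun i _ => hM _ _)

lemma contDiffOn_inv {n : Type*} [Fintype n] [DecidableEq n] {U : Set (Fin m → ℂ)}
    {M : (Fin m → ℂ) → Matrix n n ℂ} (hM : ∀ i j, ContDiffOn ℝ ∞ (fun z => M z i j) U)
    (hdet : ∀ z ∈ U, (M z).det ≠ 0) (i j : n) : ContDiffOn ℝ ∞ (fun z => (M z)⁻¹ i j) U := by
  simp only [Matrix.inv_def, Matrix.smul_apply, Ring.inverse_eq_inv', smul_eq_mul,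
    Matrix.adjugate_apply]
  refine ((contDiffOn_det hM).inv hdet).mul (contDiffOn_det fun k l => ?_)
  simp only [Matrix.updateRow_apply]
  split_ifs
  · exact contDiffOn_const
  · exact hM _ _

/-! ### The Kähler ring of a local metric -/

/-- A local metric that is smooth, Hermitian, nondegenerate and Kähler on `U`. -/
structure IsKahlerOn (G : LocalMetric m) (U : Set (Fin m → ℂ)) : Prop where
  isOpen : IsOpen U
  smooth : ∀ i j, ContDiffOn ℝ ∞ (fun z => G z i j) U
  herm : ∀ z ∈ U, ∀ i j, conj (G z i j) = G z j i
  det_ne_zero : ∀ z ∈ U, (G z).det ≠ 0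
  closed : ∀ z ∈ U, ∀ i j k,
    pd (.inl k) (fun w => G w i j) z = pd (.inl i) (fun w => G w k j) z

open Classical in
/-- The metric of `G` on `U`, extended by the identity matrix. -/
noncomputable def extMetric (G : LocalMetric m) (U : Set (Fin m → ℂ)) : LocalMetric m :=
  fun z => if z ∈ U then G z else 1

lemma extMetric_of_mem {G : LocalMetric m} {U : Set (Fin m → ℂ)} {z : Fin m → ℂ} (hz : z ∈ U) :
    extMetric G U z = G z := if_pos hz

lemma extMetric_of_notMem {G : LocalMetric m} {U : Set (Fin m → ℂ)} {z : Fin m → ℂ}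
    (hz : z ∉ U) : extMetric G U z = 1 := if_neg hz

namespace IsKahlerOn

variable {G : LocalMetric m} {U : Set (Fin m → ℂ)}

lemma extMetric_smooth (hG : IsKahlerOn G U) (i j : Fin m) : ContDiffOn ℝ ∞ (fun z => extMetric G U z i j) U :=
  (hG.smooth i j).congr fun z hz => by rw [extMetric_of_mem hz]

lemma extMetric_det (hG : IsKahlerOn G U) (z : Fin m → ℂ) : (extMetric G U z).det ≠ 0 := by
  by_cases hz : z ∈ U
  · rw [extMetric_of_mem hz]; exact hG.det_ne_zero z hz
  · simp [extMetric_of_notMem hz]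

end IsKahlerOn

/-- The Kähler structure of a local metric on the ring of smooth functions. -/
noncomputable def IsKahlerOn.toKahlerRing {G : LocalMetric m} {U : Set (Fin m → ℂ)} (hG : IsKahlerOn G U) :
    KahlerRing (Fin m) (smoothOn U) where
  D := pdOn hG.isOpen
  D_comm := pdOn_comm hG.isOpen
  star_D := star_pdOn hG.isOpen
  g := Matrix.of fun i j => ⟨fun z => extMetric G U z i j, hG.extMetric_smooth i j⟩
  h := Matrix.of fun i j => ⟨fun z => (extMetric G U z)⁻¹ j i,
    contDiffOn_inv hG.extMetric_smooth (fun z _ => hG.extMetric_det z) j i⟩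
  h_mul := by
    refine Matrix.ext fun i j => ?_
    refine smoothOn_ext fun z => ?_
    have h := congrFun (congrFun (Matrix.mul_nonsing_inv (extMetric G U z)
      (hG.extMetric_det z).isUnit) j) i
    rw [Matrix.mul_apply] at h
    simp only [Matrix.mul_apply, Matrix.transpose_apply, map_sum, map_mul]
    refine (Finset.sum_congr rfl fun x _ => mul_comm _ _).trans (h.trans ?_)
    by_cases hij : i = j
    · rw [hij, Matrix.one_apply_eq, Matrix.one_apply_eq, map_one]
    · rw [Matrix.one_apply_ne hij, Matrix.one_apply_ne (Ne.symm hij), map_zero]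
  star_g i j := by
    refine Subtype.ext (funext fun z => ?_)
    -- Ring elements are total functions, so each axiom must also hold off U; there the metric is
    -- the identity and all derivatives are zero.
    by_cases hz : z ∈ U
    · simpa [extMetric_of_mem hz] using hG.herm z hz i j
    · simp [extMetric_of_notMem hz, Matrix.one_apply, eq_comm, apply_ite]
  closed i j k := by
    refine Subtype.ext (funext fun z => ?_)
    by_cases hz : z ∈ U
    · have h : ∀ i j, (fun z => extMetric G U z i j) =ᶠ[nhds z] fun z => G z i j := fun i j =>
        Filter.eventuallyEq_of_mem (hG.isOpen.mem_nhds hz) fun y hy => by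
          simp only [extMetric_of_mem hy]
      simp only [Matrix.of_apply, pdOn_apply]
      rw [Set.indicator_of_mem hz, Set.indicator_of_mem hz, pd_congr (h _ _), pd_congr (h _ _)]
      exact hG.closed z hz i j k
    · simp [pdOn_apply, hz]
  w := ⟨fun z => (extMetric G U z).det⁻¹,
    (contDiffOn_det hG.extMetric_smooth).inv fun z _ => hG.extMetric_det z⟩
  w_mul := by
    refine smoothOn_ext fun z => ?_
    rw [map_mul, RingHom.map_det, map_one]
    exact inv_mul_cancel₀ (hG.extMetric_det z)

/-! ### Transfer to coordinate expressions -/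

/-- `X` represents the function `u` on `U`. -/
def Rep {U : Set (Fin m → ℂ)} (X : smoothOn U) (u : (Fin m → ℂ) → ℂ) : Prop :=
  ∀ z ∈ U, evalAt U z X = u z

namespace IsKahlerOn

variable {G : LocalMetric m} {U : Set (Fin m → ℂ)} (hG : IsKahlerOn G U)

/-- Agreement on the open set U suffices because a derivative depends only on the germ. -/
lemma rep_D {X : smoothOn U} {u : (Fin m → ℂ) → ℂ} (h : Rep X u) (a : Fin m ⊕ Fin m) :
    Rep (hG.toKahlerRing.D a X) (pd a u) := fun z hz => by
  change U.indicator (pd a X.1) z = _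
  rw [Set.indicator_of_mem hz]
  exact pd_congr (Filter.eventuallyEq_of_mem (hG.isOpen.mem_nhds hz) h)

lemma rep_g (i j : Fin m) : Rep (hG.toKahlerRing.g i j) (fun z => G z i j) := fun z hz => by
  change extMetric G U z i j = _
  rw [extMetric_of_mem hz]

lemma rep_h (i j : Fin m) : Rep (hG.toKahlerRing.h i j) (gUp G i j) := fun z hz => by
  change (extMetric G U z)⁻¹ j i = _
  rw [extMetric_of_mem hz, gUp]

lemma conj_gUp (hG : IsKahlerOn G U) {z : Fin m → ℂ} (hz : z ∈ U) (i j : Fin m) :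
    conj (gUp G i j z) = gUp G j i z := by
  rw [← hG.rep_h i j z hz, ← evalAt_star, hG.toKahlerRing.star_h, hG.rep_h j i z hz]

lemma rep_w : Rep hG.toKahlerRing.w (normSqFrame G) := fun z hz => by
  change (extMetric G U z).det⁻¹ = _
  rw [extMetric_of_mem hz, normSqFrame]

lemma rep_chr (i j k : Fin m) : Rep (hG.toKahlerRing.chr i j k) (christoffel G i j k) :=
  fun z hz => by
    simp only [KahlerRing.chr, christoffel, map_sum, map_mul, hG.rep_h _ _ z hz,
      hG.rep_D (hG.rep_g _ _) _ z hz]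

lemma rep_chrTr (i : Fin m) : Rep (hG.toKahlerRing.chrTr i) (connK G (.inl i)) := fun z hz => by
  simp only [KahlerRing.chrTr, connK, christoffelC, map_sum, hG.rep_chr _ _ _ z hz]

lemma connK_inr (i : Fin m) (z : Fin m → ℂ) : connK G (.inr i) z = 0 := by
  simp [connK, christoffelC]

lemma rep_ricci (i j : Fin m) : Rep (hG.toKahlerRing.ricci i j) (ricci G i j) := fun z hz => by
  simp only [KahlerRing.ricci, KahlerRing.chrTr, ricci, curvature, map_sum, map_neg,
    Finset.sum_neg_distrib, hG.rep_D (hG.rep_chr _ _ _) _ z hz]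

lemma rep_scal : Rep hG.toKahlerRing.scal (scalarCurv G) := fun z hz => by
  simp only [KahlerRing.scal, KahlerRing.tr, scalarCurv, map_sum, map_mul, hG.rep_h _ _ z hz,
    hG.rep_ricci _ _ z hz]

lemma rep_nabla {X : smoothOn U} {f : (Fin m → ℂ) → ℂ} (h : Rep X f) (a : Fin m ⊕ Fin m) :
    Rep (hG.toKahlerRing.nabla X a) (nabla G f a) := fun z hz => by
  rcases a with i | i
  · simp only [KahlerRing.nabla, nabla, map_sub, map_mul, hG.rep_D h _ z hz,
      hG.rep_chrTr _ z hz, h z hz]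
  · simp only [KahlerRing.nabla, nabla, hG.rep_D h _ z hz, connK_inr, zero_mul, sub_zero]

lemma rep_nabla₁ {X : Fin m ⊕ Fin m → smoothOn U} {T : Fin m ⊕ Fin m → (Fin m → ℂ) → ℂ}
    (h : ∀ a, Rep (X a) (T a)) (a b : Fin m ⊕ Fin m) :
    Rep (hG.toKahlerRing.nabla₁ X a b) (nabla₁ G T a b) := fun z hz => by
  rcases a with i | i <;> rcases b with k | k <;>
    simp [KahlerRing.nabla₁, nabla₁, christoffelC, connK_inr, evalAt_star,
      hG.rep_D (h _) _ z hz, hG.rep_chrTr _ z hz, hG.rep_chr _ _ _ z hz, h _ z hz]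

lemma rep_nablaSq {X : smoothOn U} {f : (Fin m → ℂ) → ℂ} (h : Rep X f) (a b : Fin m ⊕ Fin m) :
    Rep (hG.toKahlerRing.nabla₁ (hG.toKahlerRing.nabla X) a b) (nablaSq G f a b) :=
  hG.rep_nabla₁ (hG.rep_nabla h) a b

lemma rep_lapK {X : smoothOn U} {f : (Fin m → ℂ) → ℂ} (h : Rep X f) :
    Rep (hG.toKahlerRing.lapK X) (laplacianK G f) := fun z hz => by
  simp only [KahlerRing.lapK, KahlerRing.tr, laplacianK, map_sum, map_mul, hG.rep_h _ _ z hz,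
    hG.rep_nablaSq h _ _ z hz]

lemma rep_lap {X : smoothOn U} {f : (Fin m → ℂ) → ℂ} (h : Rep X f) :
    Rep (hG.toKahlerRing.lap X) (laplacian G f) := fun z hz => by
  simp only [KahlerRing.lap, KahlerRing.tr, laplacian, map_sum, map_mul, hG.rep_h _ _ z hz,
    hG.rep_D (hG.rep_D h _) _ z hz]

lemma rep_inner {X Y : Fin m ⊕ Fin m → smoothOn U} {S T : Fin m ⊕ Fin m → (Fin m → ℂ) → ℂ}
    (hX : ∀ a, Rep (X a) (S a)) (hY : ∀ a, Rep (Y a) (T a)) :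
    Rep (hG.toKahlerRing.inner X Y) (inner₁ G S T) := fun z hz => by
  simp only [KahlerRing.inner, KahlerRing.tr, inner₁, map_sum, map_mul, map_add, evalAt_star,
    hG.rep_h _ _ z hz, hG.rep_w z hz, hX _ z hz, hY _ z hz, Fintype.sum_sum_type, gUpC,
    zero_mul, Finset.sum_const_zero, add_zero, zero_add, hG.conj_gUp hz, mul_assoc]
  congr 2
  exact Finset.sum_comm

lemma rep_inner₂ {X Y : Fin m ⊕ Fin m → Fin m ⊕ Fin m → smoothOn U}
    {S T : Fin m ⊕ Fin m → Fin m ⊕ Fin m → (Fin m → ℂ) → ℂ}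
    (hX : ∀ a b, Rep (X a b) (S a b)) (hY : ∀ a b, Rep (Y a b) (T a b)) :
    Rep (hG.toKahlerRing.inner₂ X Y) (inner₂ G S T) := fun z hz => by
  have h : inner₂ G S T z = ∑ a, ∑ c, gUpC G a c z * inner₁ G (S a) (T c) z := by
    simp only [inner₂, inner₁, Finset.mul_sum]
    refine Finset.sum_congr rfl fun a _ => ?_
    rw [Finset.sum_comm]
    refine Finset.sum_congr rfl fun c _ => Finset.sum_congr rfl fun b _ =>
      Finset.sum_congr rfl fun d _ => by ring
  rw [h]
  simp only [KahlerRing.inner₂, KahlerRing.tr, map_sum, map_mul, map_add,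
    hG.rep_h _ _ z hz, hG.rep_inner (hX _) (hY _) z hz, Fintype.sum_sum_type, gUpC,
    zero_mul, Finset.sum_const_zero, add_zero, zero_add, hG.conj_gUp hz]
  congr 1
  exact Finset.sum_comm

lemma rep_part10 {X : Fin m ⊕ Fin m → smoothOn U} {T : Fin m ⊕ Fin m → (Fin m → ℂ) → ℂ}
    (h : ∀ a, Rep (X a) (T a)) (a : Fin m ⊕ Fin m) :
    Rep (KahlerRing.part10 X a) (part10 T a) := by
  rcases a with i | i
  · exact h _
  · exact fun z _ => map_zero _

lemma rep_part01 {X : Fin m ⊕ Fin m → smoothOn U} {T : Fin m ⊕ Fin m → (Fin m → ℂ) → ℂ}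
    (h : ∀ a, Rep (X a) (T a)) (a : Fin m ⊕ Fin m) :
    Rep (KahlerRing.part01 X a) (part01 T a) := by
  rcases a with i | i
  · exact fun z _ => map_zero _
  · exact h _

lemma rep_ricciAct {X : Fin m ⊕ Fin m → smoothOn U} {T : Fin m ⊕ Fin m → (Fin m → ℂ) → ℂ}
    (h : ∀ a, Rep (X a) (T a)) (a : Fin m ⊕ Fin m) :
    Rep (hG.toKahlerRing.ricciAct X a) (ricciAct G T a) := fun z hz => by
  rcases a with i | i <;>
    simp only [KahlerRing.ricciAct, KahlerRing.tr, ricciAct, map_sum, map_mul,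
      hG.rep_h _ _ z hz, hG.rep_ricci _ _ z hz, h _ z hz] <;>
    exact Finset.sum_congr rfl fun k _ => Finset.sum_congr rfl fun l _ => by ring

lemma rep_mulGradScalar {X : smoothOn U} {f : (Fin m → ℂ) → ℂ} (h : Rep X f)
    (a : Fin m ⊕ Fin m) :
    Rep (X * hG.toKahlerRing.D a hG.toKahlerRing.scal) (mulGradScalar G f a) := fun z hz => by
  simp only [mulGradScalar, map_mul, h z hz, hG.rep_D hG.rep_scal _ z hz]

/-- The Bochner formula for `(m,0)` forms in a coordinate domain. -/
theorem laplacian_inner₁_nabla (hG : IsKahlerOn G U) {f : (Fin m → ℂ) → ℂ}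
    (hf : ContDiffOn ℝ ∞ f U) {z : Fin m → ℂ} (hz : z ∈ U) :
    laplacian G (inner₁ G (nabla G f) (nabla G f)) z =
      inner₂ G (nablaSq G f) (nablaSq G f) z
      + inner₁ G (nabla G (laplacianK G f)) (nabla G f) z
      + inner₁ G (nabla G f) (nabla G (laplacianK G f)) z
      + scalarCurv G z * inner₁ G (nabla G f) (nabla G f) z
      + inner₁ G (part10 (mulGradScalar G f)) (part10 (nabla G f)) z
      + inner₁ G (part10 (nabla G f)) (part10 (mulGradScalar G f)) z
      + 3 * ricciForm G (part10 (nabla G f)) (part10 (nabla G f)) z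
      - ricciForm G (part01 (nabla G f)) (part01 (nabla G f)) z := by
  let X : smoothOn U := ⟨f, hf⟩
  have hX : Rep X f := fun _ _ => rfl
  have hN := hG.rep_nabla hX
  have hL := hG.rep_nabla (hG.rep_lapK hX)
  have hR := rep_part10 (hG.rep_mulGradScalar hX)
  have h := congrArg (evalAt U z) (hG.toKahlerRing.lap_inner_nabla X)
  simp only [map_add, map_sub, map_mul, map_ofNat] at h
  rw [hG.rep_lap (hG.rep_inner hN hN) z hz, hG.rep_inner₂ (hG.rep_nablaSq hX)
    (hG.rep_nablaSq hX) z hz, hG.rep_inner hL hN z hz, hG.rep_inner hN hL z hz,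
    hG.rep_scal z hz, hG.rep_inner hN hN z hz, hG.rep_inner hR (rep_part10 hN) z hz,
    hG.rep_inner (rep_part10 hN) hR z hz,
    hG.rep_inner (hG.rep_ricciAct (rep_part10 hN)) (rep_part10 hN) z hz,
    hG.rep_inner (hG.rep_ricciAct (rep_part01 hN)) (rep_part01 hN) z hz] at h
  exact h

end IsKahlerOn

/-! ### Einstein metrics -/

lemma inner₁_smul_left (G : LocalMetric m) {S S' T : Fin m ⊕ Fin m → (Fin m → ℂ) → ℂ}
    {z : Fin m → ℂ} {c : ℂ} (h : ∀ a, S a z = c * S' a z) :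
    inner₁ G S T z = c * inner₁ G S' T z := by
  simp only [inner₁, h, Finset.mul_sum]
  exact Finset.sum_congr rfl fun a _ => Finset.sum_congr rfl fun b _ => by ring

lemma inner₁_eq_zero_left (G : LocalMetric m) {S T : Fin m ⊕ Fin m → (Fin m → ℂ) → ℂ}
    {z : Fin m → ℂ} (h : ∀ a, S a z = 0) : inner₁ G S T z = 0 := by
  simp [inner₁, h]

lemma inner₁_eq_zero_right (G : LocalMetric m) {S T : Fin m ⊕ Fin m → (Fin m → ℂ) → ℂ}
    {z : Fin m → ℂ} (h : ∀ a, T a z = 0) : inner₁ G S T z = 0 := by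
  simp [inner₁, h]

lemma sum_gUp_mul {G : LocalMetric m} {z : Fin m → ℂ} (hdet : (G z).det ≠ 0) (i j : Fin m) :
    ∑ l, gUp G i l z * G z j l = if i = j then 1 else 0 := by
  have h := congrFun (congrFun (Matrix.mul_nonsing_inv (G z) hdet.isUnit) j) i
  rw [Matrix.mul_apply, Matrix.one_apply] at h
  simp only [gUp, mul_comm ((G z)⁻¹ _ _), h, eq_comm]

lemma sum_gUp_mul' {G : LocalMetric m} {z : Fin m → ℂ} (hdet : (G z).det ≠ 0) (i j : Fin m) :
    ∑ k, gUp G k i z * G z k j = if i = j then 1 else 0 := by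
  have h := congrFun (congrFun (Matrix.nonsing_inv_mul (G z) hdet.isUnit) i) j
  rwa [Matrix.mul_apply, Matrix.one_apply] at h

lemma scalarCurv_of_einstein {G : LocalMetric m} {z : Fin m → ℂ} (hdet : (G z).det ≠ 0) {μ : ℂ}
    (h : ∀ i j, ricci G i j z = μ * G z i j) : scalarCurv G z = m * μ := by
  simp only [scalarCurv, h, mul_left_comm _ μ, ← Finset.mul_sum, sum_gUp_mul hdet]
  simp [mul_comm]

lemma ricciAct_of_einstein {G : LocalMetric m} {z : Fin m → ℂ} (hdet : (G z).det ≠ 0) {μ : ℂ}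
    (h : ∀ i j, ricci G i j z = μ * G z i j) (T : Fin m ⊕ Fin m → (Fin m → ℂ) → ℂ)
    (a : Fin m ⊕ Fin m) : ricciAct G T a z = μ * T a z := by
  rcases a with j | j
  · have h1 : ∀ k l, μ * G z j l * gUp G k l z * T (.inl k) z =
        μ * T (.inl k) z * (gUp G k l z * G z j l) := fun k l => by ring
    simp only [ricciAct, h, h1, ← Finset.mul_sum, sum_gUp_mul hdet]
    simp
  · have h1 : ∀ k l, μ * G z k j * gUp G k l z * T (.inr l) z =
        μ * T (.inr l) z * (gUp G k l z * G z k j) := fun k l => by ring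
    simp only [ricciAct, h, h1]
    rw [Finset.sum_comm]
    simp only [← Finset.mul_sum, sum_gUp_mul' hdet]
    simp

variable {M : Type*} [TopologicalSpace M] [ChartedSpace (Fin m → ℂ) M]

/-! ### From the manifold to its charts -/

lemma coordVec_injective [IsManifold 𝓘(ℂ, Fin m → ℂ) ω M]
    {e : OpenPartialHomeomorph M (Fin m → ℂ)} (he : e ∈ holoCharts m M) {z : Fin m → ℂ}
    (hz : z ∈ e.target) {v : Fin m → ℂ} (hv : ∑ i, v i • coordVec e z i = 0) : v = 0 := by
  have he1 : e ∈ IsManifold.maximalAtlas 𝓘(ℂ, Fin m → ℂ) 1 M :=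
    IsManifold.maximalAtlas_subset_of_le (by simp) he
  have hd : e.MDifferentiable 𝓘(ℂ, Fin m → ℂ) 𝓘(ℂ, Fin m → ℂ) :=
    ⟨fun x hx => (mdifferentiableAt_of_mem_maximalAtlas he1 hx).mdifferentiableWithinAt,
      fun x hx => (mdifferentiableAt_symm_of_mem_maximalAtlas he1 hx).mdifferentiableWithinAt⟩
  have hinj := hd.symm.mfderiv_injective (x := z) hz
  let L : (Fin m → ℂ) →ₗ[ℂ] TangentSpace 𝓘(ℂ, Fin m → ℂ) (e.symm z) :=
    (mfderiv 𝓘(ℂ, Fin m → ℂ) 𝓘(ℂ, Fin m → ℂ) e.symm z).toLinearMap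
  have hL : L v = ∑ i, v i • L (Pi.single i 1) := by
    conv_lhs => rw [pi_eq_sum_univ' v, map_sum]
    refine Finset.sum_congr rfl fun i _ => ?_
    rw [map_smul]
  exact hinj ((hL.trans hv).trans (map_zero L).symm)

lemma KahlerMetric.isKahlerOn [IsManifold 𝓘(ℂ, Fin m → ℂ) ω M] (g : KahlerMetric m M)
    {e : OpenPartialHomeomorph M (Fin m → ℂ)} (he : e ∈ holoCharts m M) :
    IsKahlerOn (g.inChart e) e.target where
  isOpen := e.open_target
  smooth i j := g.smooth e he i j
  herm z _ i j := g.conj_symm _ _ _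
  det_ne_zero z hz hdet := by
    -- A null vector of the Gram matrix gives a nonzero tangent vector V with h(V,V) = 0, against
    -- positivity.
    obtain ⟨v, hv0, hv⟩ := Matrix.exists_vecMul_eq_zero_iff.mpr hdet
    have hne : ∑ i, v i • coordVec e z i ≠ 0 := fun h => hv0 (coordVec_injective he hz h)
    have hpos := g.pos _ _ hne
    have h0 : g.herm (e.symm z) (∑ i, v i • coordVec e z i) (∑ i, v i • coordVec e z i) = 0 := by
      rw [map_sum, map_sum]
      refine Finset.sum_eq_zero fun j _ => ?_
      have hj : ∑ i, v i * g.herm (e.symm z) (coordVec e z i) (coordVec e z j) = 0 :=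
        congrFun hv j
      simp [LinearMap.sum_apply, hj]
    rw [h0] at hpos
    exact lt_irrefl _ hpos
  closed z hz i j k := g.closed e he z hz i j k

lemma IsKahlerOn.laplacian_of_einstein {G : LocalMetric m} {U : Set (Fin m → ℂ)}
    (hG : IsKahlerOn G U) {f : (Fin m → ℂ) → ℂ} (hf : ContDiffOn ℝ ∞ f U) {μ : ℂ}
    (hμ : ∀ z ∈ U, ∀ i j, ricci G i j z = μ * G z i j) {z : Fin m → ℂ} (hz : z ∈ U) :
    laplacian G (inner₁ G (nabla G f) (nabla G f)) z =
      inner₂ G (nablaSq G f) (nablaSq G f) z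
      + inner₁ G (nabla G (laplacianK G f)) (nabla G f) z
      + inner₁ G (nabla G f) (nabla G (laplacianK G f)) z
      + (m : ℂ) * μ * inner₁ G (nabla G f) (nabla G f) z
      + 3 * μ * inner₁ G (part10 (nabla G f)) (part10 (nabla G f)) z
      - μ * inner₁ G (part01 (nabla G f)) (part01 (nabla G f)) z := by
  have hscal : ∀ y ∈ U, scalarCurv G y = m * μ := fun y hy =>
    scalarCurv_of_einstein (hG.det_ne_zero y hy) (hμ y hy)
  -- The Einstein condition on all of U, not only at `z`, makes R constant near `z`.
  have hgrad : ∀ a, mulGradScalar G f a z = 0 := fun a => by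
    rw [mulGradScalar, pd_congr (Filter.eventuallyEq_of_mem (hG.isOpen.mem_nhds hz) hscal),
      pd_const, mul_zero]
  have hgrad' : ∀ a, part10 (mulGradScalar G f) a z = 0 := by
    rintro (i | i)
    · exact hgrad _
    · rfl
  have hric : ∀ S T, ricciForm G S T z = μ * inner₁ G S T z := fun S T =>
    inner₁_smul_left G (ricciAct_of_einstein (hG.det_ne_zero z hz) (hμ z hz) S)
  rw [hG.laplacian_inner₁_nabla hf hz, hscal z hz, inner₁_eq_zero_right G hgrad',
    inner₁_eq_zero_left G hgrad', hric, hric]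
  ring

end KahlerBochner

open KahlerBochner
theorem lemma2p1 {m : ℕ} {M : Type*} [TopologicalSpace M] [ChartedSpace (Fin m → ℂ) M]
    [IsManifold 𝓘(ℂ, Fin m → ℂ) ω M] (g : KahlerMetric m M) (φ : TopForm m M) :
    -- the general formula, in every holomorphic chart and at every point of it
    (∀ e ∈ holoCharts m M, ∀ z ∈ e.target,
      let G := g.inChart e
      let f := φ.coeff e
      laplacian G (inner₁ G (nabla G f) (nabla G f)) z =
        inner₂ G (nablaSq G f) (nablaSq G f) z
        + inner₁ G (nabla G (laplacianK G f)) (nabla G f) z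
        + inner₁ G (nabla G f) (nabla G (laplacianK G f)) z
        + scalarCurv G z * inner₁ G (nabla G f) (nabla G f) z
        + inner₁ G (part10 (mulGradScalar G f)) (part10 (nabla G f)) z
        + inner₁ G (part10 (nabla G f)) (part10 (mulGradScalar G f)) z
        + 3 * ricciForm G (part10 (nabla G f)) (part10 (nabla G f)) z
        - ricciForm G (part01 (nabla G f)) (part01 (nabla G f)) z) ∧
    -- the Kähler–Einstein case
    (∀ μ : ℝ, g.IsEinstein μ → ∀ e ∈ holoCharts m M, ∀ z ∈ e.target,
      let G := g.inChart e
      let f := φ.coeff e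
      scalarCurv G z = (m : ℂ) * μ ∧
      laplacian G (inner₁ G (nabla G f) (nabla G f)) z =
        inner₂ G (nablaSq G f) (nablaSq G f) z
        + inner₁ G (nabla G (laplacianK G f)) (nabla G f) z
        + inner₁ G (nabla G f) (nabla G (laplacianK G f)) z
        + (m : ℂ) * μ * inner₁ G (nabla G f) (nabla G f) z
        + 3 * μ * inner₁ G (part10 (nabla G f)) (part10 (nabla G f)) z
        - μ * inner₁ G (part01 (nabla G f)) (part01 (nabla G f)) z) ∧
    -- the Calabi–Yau case
    (g.IsEinstein 0 → ∀ e ∈ holoCharts m M, ∀ z ∈ e.target,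
      let G := g.inChart e
      let f := φ.coeff e
      laplacian G (inner₁ G (nabla G f) (nabla G f)) z =
        inner₂ G (nablaSq G f) (nablaSq G f) z
        + inner₁ G (nabla G (laplacianK G f)) (nabla G f) z
        + inner₁ G (nabla G f) (nabla G (laplacianK G f)) z) := by

  refine ⟨fun e he z hz => (g.isKahlerOn he).laplacian_inner₁_nabla (φ.smooth e he) hz,
    fun μ hμ e he z hz => ⟨?_, ?_⟩, fun h0 e he z hz => ?_⟩
  · exact scalarCurv_of_einstein ((g.isKahlerOn he).det_ne_zero z hz) (hμ e he z hz)
  · exact (g.isKahlerOn he).laplacian_of_einstein (φ.smooth e he) (hμ e he) hz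
  · have h := (g.isKahlerOn he).laplacian_of_einstein (φ.smooth e he) (h0 e he) hz
    simp only [Complex.ofReal_zero, mul_zero, zero_mul, add_zero, sub_zero] at h
    exact h
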